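/- **Proposition 14.** Let $\mathcal A$ be a finite alphabet and let $\Sigma\subset\mathcal A^{\mathbb N}$ be a one-sided subshift of finite type (the set of sequences in which no word of some fixed finite set of forbidden words occurs), with shift map $\sigma(x_0,x_1,\dots)=(x_1,x_2,\dots)$. Assume $\sigma:\Sigma\to\Sigma$ is topologically transitive: for all nonempty open $U,V\subset\Sigma$ there is $n\ge 0$ with $\sigma^n(U)\cap V\ne\emptyset$. Fix $\lambda\in(0,1)$ and equip $\Sigma$ with the metric $d(\mathbf x,\mathbf y)=\lambda^{\min\{j:\,x_j\neq y_j\}}$ for $\mathbf x\ne\mathbf y$, $d(\mathbf x,\mathbf x)=0$. Let $\mathcal M_\sigma$ be the set of $\sigma$-invariant Borel probability measures on $\Sigma$. Let $\varphi:\Sigma\to\mathbb Q$ be locally constant, i.e. there is $j\ge 0$ such that $\varphi(\mathbf x)=\varphi(\mathbf y)$ whenever $x_0=y_0,\dots,x_j=y_j$. For $\mu\in\mathcal M_\sigma$ write $\varphi_*(\mu)=\int\varphi\,d\mu$ (the rotation number of $\mu$); the set $\varphi_*(\mathcal M_\sigma)\subset\mathbb R$ is the rotation set. Let $A:\Sigma\to\mathbb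 R$ be a Walters potential, i.e. a continuous function for which there is a nondecreasing $H:[0,\infty)\to[0,\infty]$ with $H(0)=0$, continuous at $0$, such that for all $s\ge 0$, all integers $k>0$ and all $\mathbf x,\mathbf y\in\Sigma$, $$\max_{0\le j<k}d(\sigma^j\mathbf x,\sigma^j\mathbf y)\le s\ \Longrightarrow\ \Bigl|\sum_{j=0}^{k-1}A(\sigma^j\mathbf x)-\sum_{j=0}^{k-1}A(\sigma^j\mathbf y)\Bigr|\le H(s).$$ For $h\in\varphi_*(\mathcal M_\sigma)$ let $\beta_{A,\varphi}(h)=\sup\{\int A\,d\mu:\ \mu\in\mathcal M_\sigma,\ \varphi_*(\mu)=h\}$. A periodic probability measure is a measure $\frac1M\sum_{j=0}^{M-1}\delta_{\sigma^j(\mathbf x)}$ with $\mathbf x\in\Sigma$, $M\ge 1$ and $\sigma^M(\mathbf x)=\mathbf x$. If $r$ is a rational number in the interior (in $\mathbb R$) of $\varphi_*(\mathcal M_\sigma)$, then $$\beta_{A,\varphi}(r)=\sup\Bigl\{\int A\,d\mu:\ \mu\in\mathcal M_\sigma,\ \varphi_*(\mu)=r,\ \mu\text{ a periodic probability measure}\Bigr\},$$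 where the set on the right is nonempty. -/

import Mathlib

open MeasureTheory SymbolicDynamics.FullShift
open scoped NNReal ENNReal

noncomputable section

namespace ErgOpt

section General

variable {X : Type*}

/-- Topological transitivity of `T`: every nonempty open set meets some forward image of every
nonempty open set. -/
def IsTransitive [TopologicalSpace X] (T : X → X) : Prop :=
  ∀ U V : Set X, IsOpen U → IsOpen V → U.Nonempty → V.Nonempty →
    ∃ n : ℕ, (T^[n] '' U ∩ V).Nonempty

/-- The `T`-invariant probability measures. -/
def invariantMeasures [MeasurableSpace X] (T : X → X) : Set (Measure X) :=
  {μ | IsProbabilityMeasure μ ∧ MeasurePreserving T μ μ}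

/-- The rotation number of `μ` for the constraint `φ`. -/
def rotationNumber [MeasurableSpace X] (φ : X → ℝ) (μ : Measure X) : ℝ :=
  ∫ x, φ x ∂μ

/-- The rotation set: all rotation numbers of invariant probability measures. -/
def rotationSet [MeasurableSpace X] (T : X → X) (φ : X → ℝ) : Set ℝ :=
  rotationNumber φ '' invariantMeasures T

/-- The rotation class of `h`: the invariant probability measures with rotation number `h`. -/
def rotationClass [MeasurableSpace X] (T : X → X) (φ : X → ℝ) (h : ℝ) : Set (Measure X) :=
  {μ | μ ∈ invariantMeasures T ∧ rotationNumber φ μ = h}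

/-- The beta function, at points `h` of the rotation set. -/
def beta [MeasurableSpace X] (T : X → X) (A φ : X → ℝ) (h : ℝ) : ℝ :=
  sSup ((fun μ : Measure X => ∫ x, A x ∂μ) '' rotationClass T φ h)

/-- `μ` is equidistributed on a periodic orbit. Every positive period `M` of the point `x`, minimal
or not, gives the same measure. -/
def IsPeriodicMeasure [MeasurableSpace X] (T : X → X) (μ : Measure X) : Prop :=
  ∃ (x : X) (M : ℕ), 0 < M ∧ Function.IsPeriodicPt T M x ∧
    μ = (M : ℝ≥0∞)⁻¹ • ∑ j ∈ Finset.range M, Measure.dirac (T^[j] x)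

/-- The dynamical distance `max_{0 ≤ j < k} d (T^j x) (T^j y)`. -/
def dynDist (T : X → X) (d : X → X → ℝ≥0) (k : ℕ) (x y : X) : ℝ≥0 :=
  (Finset.range k).sup fun j => d (T^[j] x) (T^[j] y)

/-- Walters functions, for a distance `d` inducing the topology of `X`: continuous functions
with a Walters module `H`. -/
def IsWalters [TopologicalSpace X] (T : X → X) (d : X → X → ℝ≥0) (A : X → ℝ) : Prop :=
  Continuous A ∧ ∃ H : ℝ≥0 → ℝ≥0∞, Monotone H ∧ H 0 = 0 ∧ ContinuousAt H 0 ∧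
    ∀ (s : ℝ≥0) (k : ℕ), 0 < k → ∀ x y : X, dynDist T d k x y ≤ s →
      ENNReal.ofReal |birkhoffSum T A k x - birkhoffSum T A k y| ≤ H s

end General

section Symbolic

variable {α : Type*} [TopologicalSpace α]

/-- A one-sided subshift is of finite type if it consists of the sequences in which no word of
some finite set `F` of forbidden words occurs. -/
def IsFiniteType (S : Subshift α ℕ) : Prop :=
  ∃ F : Set (List α), F.Finite ∧
    S.carrier = {x | ∀ w ∈ F, ∀ i : ℕ, List.ofFn (fun k : Fin w.length => x (i + k)) ≠ w}

/-- The left shift `(x₀, x₁, …) ↦ (x₁, x₂, …)` on a one-sided subshift. -/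
def shiftMap (S : Subshift α ℕ) : S.carrier → S.carrier :=
  (S.mapsTo 1).restrict

/-- The distance `lam ^ min {j | x j ≠ y j}` (and `0` if `x = y`). For `0 < lam < 1` and a discrete
alphabet it induces the product topology. -/
def shiftDist (S : Subshift α ℕ) (lam : ℝ≥0) (x y : S.carrier) : ℝ≥0 :=
  open Classical in
  if x = y then 0 else lam ^ PiNat.firstDiff (E := fun _ => α) x.1 y.1

/-- `g` depends only on the coordinates `0, …, j`, for some `j`. -/
def IsLocConst {β : Type*} (S : Subshift α ℕ) (g : S.carrier → β) : Prop :=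
  ∃ j : ℕ, ∀ x y : S.carrier, (∀ i ≤ j, x.1 i = y.1 i) → g x = g y

end Symbolic

end ErgOpt

end

/-! Write `σ` for the shift. A continuous `A` is a uniform limit of functions of finitely many
coordinates, so it suffices to find, for such a function `ψ` with `∫ ψ ∂μ > 0` and for `φ` centred
at `r = 0`, a periodic orbit along which `φ` sums to `0` and `ψ` has a positive sum.

Two facts are used. Since orbit segments close up at bounded cost, a function of finitely many
coordinates whose sums along periodic orbits are all nonpositive has nonpositive integral against
every invariant measure. And if `(X, Y)` and `(X', Y')` are the sums of `(φ, ψ)` along two periodic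
orbits with `X' < 0 < X`, then, running many times through both orbits and connecting them by fixed
transition words, one gets periodic orbits with `φ`-sum exactly `0`, because the sums of `φ` are
commensurable; their `ψ`-sum is eventually positive when `Y / X > Y' / X'`.

So if no orbit as desired exists, then `Y / X ≤ Y' / X'` for all such pairs, and a number `a` that
separates the two sets of slopes is a Lagrange multiplier: all sums of `ψ - a φ` along periodic
orbits are nonpositive, hence `∫ ψ ∂μ = ∫ (ψ - a φ) ∂μ ≤ 0`, a contradiction. Orbits with `φ`-sums
of both signs exist because `0` is an interior point of the rotation set. -/

open Filter Function Topology

namespace ErgOpt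

section Arithmetic

theorem exists_nat_mul_eq_int_mul (x : ℚ) {y : ℚ} (hy : y ≠ 0) :
    ∃ (n : ℕ) (m : ℤ), 0 < n ∧ n * x = m * y := by
  refine ⟨(x / y).den, (x / y).num, (x / y).pos, ?_⟩
  rw [← Rat.den_mul_eq_num, mul_assoc, div_mul_cancel₀ _ hy]

theorem exists_nsmul_add_fst_eq_zero_and_snd_pos {p q : ℚ × ℝ} (w : ℚ × ℝ) (hp : 0 < p.1)
    (hq : q.1 < 0) (h : 0 < p.2 * -q.1 + q.2 * p.1) :
    ∃ a b c : ℕ, 0 < c ∧ (a • p + b • q + c • w).1 = 0 ∧ 0 < (a • p + b • q + c • w).2 := by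
  obtain ⟨t, s, ht, hst⟩ := exists_nat_mul_eq_int_mul (-q.1) hp.ne'
  obtain ⟨c, m, hc, hcm⟩ := exists_nat_mul_eq_int_mul w.1 hp.ne'
  have hp' : (0 : ℝ) < p.1 := by exact_mod_cast hp
  have hst' : (t : ℝ) * -q.1 = s * p.1 := by exact_mod_cast hst
  have ht' : (0 : ℝ) < t := by exact_mod_cast ht
  have hs : (1 : ℝ) ≤ s := by
    have : 0 < (s : ℚ) * p.1 := hst ▸ mul_pos (by exact_mod_cast ht) (neg_pos.2 hq)
    exact_mod_cast Int.cast_pos.1 (pos_of_mul_pos_left this hp.le)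
  have hη : 0 < s * p.2 + t * q.2 := by
    refine pos_of_mul_pos_left (b := (p.1 : ℝ)) ?_ hp'.le
    calc (0 : ℝ) < t * (p.2 * -q.1 + q.2 * p.1) := mul_pos ht' h
      _ = (s * p.2 + t * q.2) * p.1 := by linear_combination p.2 * hst'
  obtain ⟨k, hk⟩ := exists_nat_gt (max (m : ℝ) ((m * p.2 - c * w.2) / (s * p.2 + t * q.2)))
  obtain ⟨hkm, hkη⟩ := max_lt_iff.1 hk
  rw [div_lt_iff₀ hη] at hkη
  obtain ⟨a, ha⟩ : ∃ a : ℕ, k * s - m = (a : ℤ) := by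
    refine Int.eq_ofNat_of_zero_le ?_
    have : (m : ℝ) ≤ k * s := hkm.le.trans (le_mul_of_one_le_right k.cast_nonneg hs)
    exact sub_nonneg.2 (by exact_mod_cast this)
  refine ⟨a, k * t, c, hc, ?_, ?_⟩
  · have ha' : (k : ℚ) * s - m = a := by exact_mod_cast ha
    simp only [Prod.fst_add, Prod.smul_fst]
    simp only [nsmul_eq_mul, Nat.cast_mul, ← ha']
    linear_combination hcm - k * hst
  · have ha' : (k : ℝ) * s - m = a := by exact_mod_cast ha
    simp only [Prod.snd_add, Prod.smul_snd]
    simp only [nsmul_eq_mul, Nat.cast_mul, ← ha']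
    linarith

theorem exists_forall_le_mul {ι : Type*} {X Y : ι → ℝ} (hpos : ∃ i, 0 < X i) (hneg : ∃ i, X i < 0)
    (hzero : ∀ i, X i = 0 → Y i ≤ 0)
    (hpair : ∀ i j, 0 < X i → X j < 0 → Y i * -X j + Y j * X i ≤ 0) :
    ∃ a, ∀ i, Y i ≤ a * X i := by
  obtain ⟨a, hle, hge⟩ : (upperBounds ((fun i => Y i / X i) '' {i | 0 < X i}) ∩
      lowerBounds ((fun i => Y i / X i) '' {i | X i < 0})).Nonempty := by
    refine exists_between_of_forall_le (Set.Nonempty.image _ hpos) (Set.Nonempty.image _ hneg) ?_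
    rintro _ ⟨i, hi, rfl⟩ _ ⟨j, hj, rfl⟩
    rw [div_le_iff₀ hi, div_mul_eq_mul_div, le_div_iff_of_neg hj]
    linarith [hpair i j hi hj]
  refine ⟨a, fun i => ?_⟩
  rcases lt_trichotomy (X i) 0 with hi | hi | hi
  · exact (le_div_iff_of_neg hi).1 (hge ⟨i, hi, rfl⟩)
  · simpa [hi] using hzero i hi
  · exact (div_le_iff₀ hi).1 (hle ⟨i, hi, rfl⟩)

end Arithmetic

section BirkhoffSums

variable {X : Type*} {T : X → X}

/-- The Birkhoff sums of `f` along periodic orbits of `T`, each traversed any number of times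
(possibly `0`). -/
def periodicSums {G : Type*} [AddCommMonoid G] (T : X → X) (f : X → G) : Set G :=
  {v | ∃ (x : X) (n : ℕ), IsPeriodicPt T n x ∧ birkhoffSum T f n x = v}

theorem periodicSums_comp {G H : Type*} [AddCommMonoid G] [AddCommMonoid H] (l : G →+ H)
    (f : X → G) : periodicSums T (l ∘ f) = l '' periodicSums T f := by
  ext v
  simp only [periodicSums, Set.mem_ofPred_eq, Set.mem_image, ← map_birkhoffSum]
  grind

variable [MeasurableSpace X] {μ : Measure X}

theorem integrable_comp_iterate {E : Type*} [NormedAddCommGroup E] (hT : MeasurePreserving T μ μ)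
    {g : X → E} (hg : Integrable g μ) (n : ℕ) : Integrable (fun x => g (T^[n] x)) μ :=
  (hT.iterate n).integrable_comp_of_integrable hg

theorem integrable_birkhoffSum {E : Type*} [NormedAddCommGroup E] (hT : MeasurePreserving T μ μ)
    {g : X → E} (hg : Integrable g μ) (n : ℕ) : Integrable (birkhoffSum T g n) μ :=
  integrable_finsetSum _ fun j _ => integrable_comp_iterate hT hg j

theorem integral_birkhoffSum {E : Type*} [NormedAddCommGroup E] [NormedSpace ℝ E]
    (hT : MeasurePreserving T μ μ) {g : X → E} (hg : Integrable g μ) (n : ℕ) :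
    ∫ x, birkhoffSum T g n x ∂μ = n • ∫ x, g x ∂μ := by
  have hcomp (j : ℕ) : ∫ x, g (T^[j] x) ∂μ = ∫ x, g x ∂μ := by
    have hj := hT.iterate j
    rw [← integral_map hj.aemeasurable (hj.map_eq.symm ▸ hg.1), hj.map_eq]
  simp only [birkhoffSum]
  rw [integral_finsetSum _ fun j _ => integrable_comp_iterate hT hg j]
  simp only [hcomp, Finset.sum_const, Finset.card_range]

theorem integral_nonpos_of_forall_birkhoffSum_le [IsFiniteMeasure μ]
    (hT : MeasurePreserving T μ μ) {g : X → ℝ} (hg : Integrable g μ) {C : ℝ}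
    (hC : ∀ n x, birkhoffSum T g n x ≤ C) : ∫ x, g x ∂μ ≤ 0 := by
  by_contra! hpos
  obtain ⟨n, hn⟩ := exists_lt_nsmul hpos (μ.real Set.univ * C)
  refine hn.not_ge ?_
  calc n • ∫ x, g x ∂μ = ∫ x, birkhoffSum T g n x ∂μ := (integral_birkhoffSum hT hg n).symm
    _ ≤ ∫ _, C ∂μ := integral_mono (integrable_birkhoffSum hT hg n) (integrable_const C) (hC n)
    _ = μ.real Set.univ * C := by rw [integral_const, smul_eq_mul]

end BirkhoffSums

section OrbitMeasure

variable {X : Type*} [MeasurableSpace X] {T : X → X} {x : X} {M : ℕ}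

/-- The measure equidistributed on the first `M` points of the orbit of `x`, which is the periodic
measure of the orbit if `M` is a positive period of `x`. It is the zero measure if `M = 0`. -/
noncomputable def orbitMeasure (T : X → X) (M : ℕ) (x : X) : Measure X :=
  (M : ℝ≥0∞)⁻¹ • ∑ j ∈ Finset.range M, Measure.dirac (T^[j] x)

theorem isProbabilityMeasure_orbitMeasure (hM : 0 < M) :
    IsProbabilityMeasure (orbitMeasure T M x) := by
  constructor
  simp only [orbitMeasure, Measure.smul_apply, Measure.finsetSum_apply, measure_univ,
    Finset.sum_const, Finset.card_range, nsmul_eq_mul, mul_one, smul_eq_mul]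
  exact ENNReal.inv_mul_cancel (by exact_mod_cast hM.ne') (ENNReal.natCast_ne_top M)

theorem measurePreserving_orbitMeasure (hT : Measurable T) (hx : IsPeriodicPt T M x) :
    MeasurePreserving T (orbitMeasure T M x) (orbitMeasure T M x) := by
  have hcycle : ∑ j ∈ Finset.range M, Measure.dirac (T^[j + 1] x) =
      ∑ j ∈ Finset.range M, Measure.dirac (T^[j] x) := by
    cases M with
    | zero => simp only [Finset.range_zero, Finset.sum_empty]
    | succ k =>
      rw [Finset.sum_range_succ, hx.eq, Finset.sum_range_succ' fun j => Measure.dirac (T^[j] x),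
        iterate_zero_apply]
  refine ⟨hT, ?_⟩
  rw [orbitMeasure, Measure.map_smul, ← Measure.mapₗ_apply_of_measurable hT, map_sum]
  simp only [Measure.mapₗ_apply_of_measurable hT, Measure.map_dirac' hT,
    ← iterate_succ_apply' T, hcycle]

theorem orbitMeasure_mem_invariantMeasures (hT : Measurable T) (hM : 0 < M)
    (hx : IsPeriodicPt T M x) : orbitMeasure T M x ∈ invariantMeasures T :=
  ⟨isProbabilityMeasure_orbitMeasure hM, measurePreserving_orbitMeasure hT hx⟩

theorem integral_orbitMeasure [MeasurableSingletonClass X] {E : Type*} [NormedAddCommGroup E]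
    [NormedSpace ℝ E] [CompleteSpace E] (g : X → E) :
    ∫ y, g y ∂orbitMeasure T M x = birkhoffAverage ℝ T g M x := by
  rw [orbitMeasure, integral_smul_measure,
    integral_finsetSum_measure fun j _ => integrable_dirac (by simp)]
  simp [integral_dirac, birkhoffAverage, birkhoffSum]

theorem integral_addMonoidHom_comp_orbitMeasure [MeasurableSingletonClass X] {G : Type*}
    [AddCommMonoid G] (l : G →+ ℝ) (F : X → G) :
    ∫ y, l (F y) ∂orbitMeasure T M x = (M : ℝ)⁻¹ * l (birkhoffSum T F M x) := by
  rw [map_birkhoffSum]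
  exact integral_orbitMeasure (l ∘ F)

end OrbitMeasure

section Paths

variable {α : Type*} [TopologicalSpace α] {S : Subshift α ℕ} {N : ℕ}

/-- `S` is an `N`-step subshift: a sequence belongs to `S` as soon as each of its words of length
`N + 1` is the initial word of a point of `S`. -/
def HasMemory (S : Subshift α ℕ) (N : ℕ) : Prop :=
  ∀ x : ℕ → α, (∀ i, ∃ y ∈ S.carrier, ∀ k ≤ N, x (i + k) = y k) → x ∈ S.carrier

/-- `g` depends only on the first `N` coordinates. In contrast to `IsLocConst`, `N = 0` means
that `g` is constant. -/
def DependsOnPrefix {β : Type*} (N : ℕ) (g : S.carrier → β) : Prop :=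
  ∀ x y : S.carrier, x.1 ∈ PiNat.cylinder y.1 N → g x = g y

/-- There is an orbit segment of length `n` from the `N`-cylinder of `x` to that of `y` along which
`f` has Birkhoff sum `v`. Such segments can be concatenated if `S` has memory `N` and `f` depends
only on the first `N` coordinates. -/
def HasPath {G : Type*} [AddCommMonoid G] (N : ℕ) (f : S.carrier → G) (x y : S.carrier) (n : ℕ)
    (v : G) : Prop :=
  ∃ z : S.carrier, z.1 ∈ PiNat.cylinder x.1 N ∧
    ((shiftMap S)^[n] z).1 ∈ PiNat.cylinder y.1 N ∧ birkhoffSum (shiftMap S) f n z = v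

theorem IsFiniteType.eventually_hasMemory (hS : IsFiniteType S) : ∀ᶠ N in atTop, HasMemory S N := by
  obtain ⟨F, hF, hSF⟩ := hS
  obtain ⟨L, hL⟩ := (hF.image List.length).bddAbove
  filter_upwards [eventually_ge_atTop L] with N hN x hx
  rw [hSF]
  intro w hw i hi
  obtain ⟨y, hy, hxy⟩ := hx i
  rw [hSF] at hy
  have hlen : w.length ≤ N := (hL ⟨w, hw, rfl⟩).trans hN
  refine hy w hw 0 ((congrArg List.ofFn (funext fun k => ?_)).trans hi)
  rw [zero_add, hxy k (k.2.le.trans hlen)]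

theorem IsLocConst.eventually_dependsOnPrefix {β : Type*} {g : S.carrier → β}
    (hg : IsLocConst S g) : ∀ᶠ N in atTop, DependsOnPrefix N g := by
  obtain ⟨j, hj⟩ := hg
  filter_upwards [eventually_gt_atTop j] with N hN x y hxy
  exact hj x y fun i hi => hxy i (hi.trans_lt hN)

theorem coe_iterate_shiftMap (x : S.carrier) (n i : ℕ) :
    ((shiftMap S)^[n] x).1 i = x.1 (n + i) := by
  induction n generalizing x with
  | zero => simp
  | succ n ih =>
    rw [iterate_succ_apply, ih]
    exact congrArg x.1 (by omega : 1 + (n + i) = n + 1 + i)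

theorem HasMemory.exists_concat (hS : HasMemory S N) {x y : S.carrier} {n : ℕ}
    (h : ((shiftMap S)^[n] x).1 ∈ PiNat.cylinder y.1 N) :
    ∃ z : S.carrier, z.1 ∈ PiNat.cylinder x.1 (n + N) ∧ (shiftMap S)^[n] z = y := by
  let z : ℕ → α := fun i => if i < n then x.1 i else y.1 (i - n)
  have hzy (i : ℕ) : z (n + i) = y.1 i := by simp [z]
  have hzx : z ∈ PiNat.cylinder x.1 (n + N) := fun i hi => by
    rcases lt_or_ge i n with hin | hni
    · exact if_pos hin
    · obtain ⟨k, rfl⟩ := Nat.exists_eq_add_of_le hni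
      rw [hzy, ← h k (by omega), coe_iterate_shiftMap]
  refine ⟨⟨z, hS z fun i => ?_⟩, hzx, Subtype.ext (funext fun i => ?_)⟩
  · rcases lt_or_ge i n with hin | hni
    · refine ⟨_, ((shiftMap S)^[i] x).2, fun k hk => ?_⟩
      rw [coe_iterate_shiftMap, hzx _ (by omega)]
    · obtain ⟨l, rfl⟩ := Nat.exists_eq_add_of_le hni
      refine ⟨_, ((shiftMap S)^[l] y).2, fun k _ => ?_⟩
      rw [coe_iterate_shiftMap, add_assoc, hzy]
  · rw [coe_iterate_shiftMap]
    exact hzy i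

theorem HasMemory.exists_isPeriodicPt (hS : HasMemory S N) {x : S.carrier} {n : ℕ}
    (h : ((shiftMap S)^[n] x).1 ∈ PiNat.cylinder x.1 N) :
    ∃ z : S.carrier, z.1 ∈ PiNat.cylinder x.1 (n + N) ∧ IsPeriodicPt (shiftMap S) n z := by
  rcases n.eq_zero_or_pos with rfl | hn
  · exact ⟨x, PiNat.self_mem_cylinder _ _, isPeriodicPt_zero _ x⟩
  have hmod : ∀ i < n + N, x.1 (i % n) = x.1 i := by
    intro i
    induction i using Nat.strong_induction_on with
    | _ i ih =>
      intro hi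
      rcases lt_or_ge i n with hin | hni
      · rw [Nat.mod_eq_of_lt hin]
      · obtain ⟨k, rfl⟩ := Nat.exists_eq_add_of_le hni
        rw [Nat.add_mod_left, ih k (by omega) (by omega), ← h k (by omega), coe_iterate_shiftMap]
  refine ⟨⟨fun i => x.1 (i % n), hS _ fun i => ⟨_, ((shiftMap S)^[i % n] x).2, fun k hk => ?_⟩⟩,
    hmod, Subtype.ext (funext fun i => ?_)⟩
  · have := Nat.mod_lt i hn
    rw [coe_iterate_shiftMap, ← hmod (i % n + k) (by omega), Nat.mod_add_mod]
  · rw [coe_iterate_shiftMap]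
    exact congrArg x.1 (Nat.add_mod_left n i)

variable {G : Type*} [AddCommMonoid G] {f : S.carrier → G}

theorem DependsOnPrefix.birkhoffSum_eq (hf : DependsOnPrefix N f) {x y : S.carrier} {n : ℕ}
    (h : x.1 ∈ PiNat.cylinder y.1 (n + N)) :
    birkhoffSum (shiftMap S) f n x = birkhoffSum (shiftMap S) f n y := by
  refine Finset.sum_congr rfl fun k hk => hf _ _ fun i hi => ?_
  rw [Finset.mem_range] at hk
  rw [coe_iterate_shiftMap, coe_iterate_shiftMap, h _ (by omega)]

theorem HasPath.congr {x x' y y' : S.carrier} {n : ℕ} {v : G} (h : HasPath N f x y n v)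
    (hx : x.1 ∈ PiNat.cylinder x'.1 N) (hy : y.1 ∈ PiNat.cylinder y'.1 N) :
    HasPath N f x' y' n v := by
  obtain ⟨z, hzx, hzy, hz⟩ := h
  exact ⟨z, fun i hi => (hzx i hi).trans (hx i hi), fun i hi => (hzy i hi).trans (hy i hi), hz⟩

theorem hasPath_iterate (N : ℕ) (f : S.carrier → G) (x : S.carrier) (n : ℕ) :
    HasPath N f x ((shiftMap S)^[n] x) n (birkhoffSum (shiftMap S) f n x) :=
  ⟨x, PiNat.self_mem_cylinder _ _, PiNat.self_mem_cylinder _ _, rfl⟩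

theorem HasPath.trans (hS : HasMemory S N) (hf : DependsOnPrefix N f) {x y t : S.carrier}
    {n m : ℕ} {v w : G} (h : HasPath N f x y n v) (h' : HasPath N f y t m w) :
    HasPath N f x t (n + m) (v + w) := by
  obtain ⟨p, hpx, hpy, rfl⟩ := h
  obtain ⟨q, hqy, hqt, rfl⟩ := h'
  obtain ⟨z, hzp, rfl⟩ := hS.exists_concat fun i hi => (hpy i hi).trans (hqy i hi).symm
  refine ⟨z, fun i hi => (hzp i (by omega)).trans (hpx i hi), ?_, ?_⟩
  · rwa [add_comm, iterate_add_apply]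
  · rw [birkhoffSum_add, hf.birkhoffSum_eq hzp]

theorem HasPath.nsmul (hS : HasMemory S N) (hf : DependsOnPrefix N f) {x : S.carrier}
    {n : ℕ} {v : G} (h : HasPath N f x x n v) (k : ℕ) : HasPath N f x x (k * n) (k • v) := by
  induction k with
  | zero => simpa using hasPath_iterate N f x 0
  | succ k ih =>
    rw [add_mul, one_mul, succ_nsmul]
    exact ih.trans hS hf h

theorem HasPath.mem_periodicSums (hS : HasMemory S N) (hf : DependsOnPrefix N f) {x : S.carrier}
    {n : ℕ} {v : G} (h : HasPath N f x x n v) : v ∈ periodicSums (shiftMap S) f := by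
  obtain ⟨p, hpx, hpy, rfl⟩ := h
  obtain ⟨z, hzp, hz⟩ := hS.exists_isPeriodicPt fun i hi => (hpy i hi).trans (hpx i hi).symm
  exact ⟨z, n, hz, hf.birkhoffSum_eq hzp⟩

theorem hasPath_of_mem_periodicSums (N : ℕ) {v : G} (hv : v ∈ periodicSums (shiftMap S) f) :
    ∃ x n, HasPath N f x x n v := by
  obtain ⟨x, n, hx, rfl⟩ := hv
  refine ⟨x, n, ?_⟩
  simpa only [hx.eq] using hasPath_iterate N f x n

end Paths

section Cylinders

variable {α : Type*} [TopologicalSpace α] {S : Subshift α ℕ} {N : ℕ}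

theorem exists_cylinder_representatives [Finite α] (S : Subshift α ℕ) (N : ℕ) :
    ∃ ρ : S.carrier → S.carrier, (Set.range ρ).Finite ∧ DependsOnPrefix N ρ ∧
      ∀ x, (ρ x).1 ∈ PiNat.cylinder x.1 N := by
  let π : S.carrier → Fin N → α := fun x i => x.1 i
  refine ⟨Set.rangeSplitting π ∘ Set.rangeFactorization π, ?_, fun x y h => ?_, fun x i hi => ?_⟩
  · exact (Set.finite_range (Set.rangeSplitting π)).subset (Set.range_comp_subset_range _ _)
  · exact congrArg (Set.rangeSplitting π) (Subtype.ext (funext fun i => h i i.2))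
  · exact congrFun (Set.apply_rangeSplitting π (Set.rangeFactorization π x)) ⟨i, hi⟩

variable [DiscreteTopology α]

theorem isOpen_setOf_mem_cylinder (x : S.carrier) (N : ℕ) :
    IsOpen {y : S.carrier | y.1 ∈ PiNat.cylinder x.1 N} :=
  (PiNat.isOpen_cylinder _ x.1 N).preimage continuous_subtype_val

theorem DependsOnPrefix.continuous {β : Type*} [TopologicalSpace β] {g : S.carrier → β}
    (hg : DependsOnPrefix N g) : Continuous g :=
  ((IsLocallyConstant.iff_exists_open g).2 fun x => ⟨_, isOpen_setOf_mem_cylinder x N,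
    PiNat.self_mem_cylinder _ _, fun y hy => hg y x hy⟩).continuous

instance compactSpace_carrier [Finite α] (S : Subshift α ℕ) : CompactSpace S.carrier :=
  isCompact_iff_compactSpace.1 S.isClosed.isCompact

theorem eventually_forall_mem_cylinder_dist_lt [Finite α] {β : Type*} [PseudoMetricSpace β]
    {A : S.carrier → β} (hA : Continuous A) {ε : ℝ} (hε : 0 < ε) :
    ∀ᶠ N in atTop, ∀ x y : S.carrier, x.1 ∈ PiNat.cylinder y.1 N → dist (A x) (A y) < ε := by
  let _ : MetricSpace (ℕ → α) := PiNat.metricSpace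
  obtain ⟨δ, hδ, hAδ⟩ :=
    Metric.uniformContinuous_iff.1 (CompactSpace.uniformContinuous_of_continuous hA) ε hε
  have hlim : Tendsto (fun N : ℕ => (1 / 2 : ℝ) ^ N) atTop (𝓝 0) :=
    tendsto_pow_atTop_nhds_zero_of_lt_one (by norm_num) (by norm_num)
  filter_upwards [hlim.eventually_lt_const hδ] with N hN x y hxy
  exact hAδ ((PiNat.mem_cylinder_iff_dist_le.1 hxy).trans_lt hN)

theorem eventually_exists_dependsOnPrefix_dist_lt [Finite α] {β : Type*} [PseudoMetricSpace β]
    {A : S.carrier → β} (hA : Continuous A) {ε : ℝ} (hε : 0 < ε) :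
    ∀ᶠ N in atTop, ∃ g : S.carrier → β, DependsOnPrefix N g ∧ ∀ x, dist (g x) (A x) < ε := by
  filter_upwards [eventually_forall_mem_cylinder_dist_lt hA hε] with N hN
  obtain ⟨ρ, -, hρ, hρx⟩ := exists_cylinder_representatives S N
  exact ⟨A ∘ ρ, fun x y h => congrArg A (hρ x y h), fun x => hN _ _ (hρx x)⟩

end Cylinders

section Transitive

variable {α : Type*} [TopologicalSpace α] [DiscreteTopology α] {S : Subshift α ℕ} {N : ℕ}
  {G : Type*} [AddCommMonoid G]

theorem IsTransitive.exists_hasPath (hT : IsTransitive (shiftMap S)) (N : ℕ) (f : S.carrier → G)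
    (x y : S.carrier) : ∃ n v, HasPath N f x y n v := by
  obtain ⟨n, -, ⟨z, hzx, rfl⟩, hzy⟩ := hT _ _ (isOpen_setOf_mem_cylinder x N)
    (isOpen_setOf_mem_cylinder y N) ⟨x, PiNat.self_mem_cylinder _ _⟩
    ⟨y, PiNat.self_mem_cylinder _ _⟩
  exact ⟨n, _, z, hzx, hzy, rfl⟩

theorem IsTransitive.exists_forall_hasPath_ge [Finite α] (hT : IsTransitive (shiftMap S)) (N : ℕ)
    (f : S.carrier → ℝ) : ∃ C : ℝ, ∀ x y, ∃ n v, C ≤ v ∧ HasPath N f x y n v := by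
  obtain ⟨ρ, hρ, -, hρx⟩ := exists_cylinder_representatives S N
  choose n v hpath using hT.exists_hasPath N f
  obtain ⟨C, hC⟩ := (hρ.image2 v hρ).bddBelow
  exact ⟨C, fun x y => ⟨_, _, hC (Set.mem_image2_of_mem ⟨x, rfl⟩ ⟨y, rfl⟩),
    (hpath _ _).congr (hρx x) (hρx y)⟩⟩

theorem exists_forall_birkhoffSum_le [Finite α] (hS : HasMemory S N)
    (hT : IsTransitive (shiftMap S)) {f : S.carrier → ℝ} (hf : DependsOnPrefix N f)
    (h : ∀ v ∈ periodicSums (shiftMap S) f, v ≤ 0) :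
    ∃ C : ℝ, ∀ n x, birkhoffSum (shiftMap S) f n x ≤ C := by
  obtain ⟨C, hC⟩ := hT.exists_forall_hasPath_ge N f
  refine ⟨-C, fun n x => ?_⟩
  obtain ⟨m, w, hw, hback⟩ := hC ((shiftMap S)^[n] x) x
  have hloop := (hasPath_iterate N f x n).trans hS hf hback
  linarith [h _ (hloop.mem_periodicSums hS hf)]

theorem exists_forall_nsmul_add_mem_periodicSums (hS : HasMemory S N)
    (hT : IsTransitive (shiftMap S)) {f : S.carrier → G} (hf : DependsOnPrefix N f) {v w : G}
    (hv : v ∈ periodicSums (shiftMap S) f) (hw : w ∈ periodicSums (shiftMap S) f) :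
    ∃ u : G, ∀ a b c : ℕ, 0 < c → a • v + b • w + c • u ∈ periodicSums (shiftMap S) f := by
  obtain ⟨x, m, hvx⟩ := hasPath_of_mem_periodicSums N hv
  obtain ⟨y, n, hwy⟩ := hasPath_of_mem_periodicSums N hw
  obtain ⟨k, s, hs⟩ := hT.exists_hasPath N f x y
  obtain ⟨l, t, ht⟩ := hT.exists_hasPath N f y x
  refine ⟨s + t, fun a b c hc => ?_⟩
  obtain ⟨c, rfl⟩ := Nat.exists_eq_succ_of_ne_zero hc.ne'
  have hdetour := (hs.trans hS hf (hwy.nsmul hS hf b)).trans hS hf ht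
  have hloop := ((hvx.nsmul hS hf a).trans hS hf hdetour).trans hS hf
    ((hs.trans hS hf ht).nsmul hS hf c)
  have hsum : a • v + b • w + (c + 1) • (s + t) = a • v + (s + b • w + t) + c • (s + t) := by
    rw [succ_nsmul]
    abel
  exact hsum ▸ hloop.mem_periodicSums hS hf

theorem exists_mem_periodicSums_fst_eq_zero_and_snd_pos (hS : HasMemory S N)
    (hT : IsTransitive (shiftMap S)) {F : S.carrier → ℚ × ℝ} (hF : DependsOnPrefix N F)
    {p q : ℚ × ℝ} (hp : p ∈ periodicSums (shiftMap S) F) (hq : q ∈ periodicSums (shiftMap S) F)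
    (hp₀ : 0 < p.1) (hq₀ : q.1 < 0) (hpq : 0 < p.2 * -q.1 + q.2 * p.1) :
    ∃ v ∈ periodicSums (shiftMap S) F, v.1 = 0 ∧ 0 < v.2 := by
  obtain ⟨u, hu⟩ := exists_forall_nsmul_add_mem_periodicSums hS hT hF hp hq
  obtain ⟨a, b, c, hc, hfst, hsnd⟩ := exists_nsmul_add_fst_eq_zero_and_snd_pos u hp₀ hq₀ hpq
  exact ⟨_, hu a b c hc, hfst, hsnd⟩

end Transitive

section InvariantMeasures

theorem measurable_shiftMap {α : Type*} [TopologicalSpace α] [MeasurableSpace α]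
    (S : Subshift α ℕ) : Measurable (shiftMap S) :=
  Measurable.subtype_mk <| measurable_pi_lambda _ fun i =>
    show Measurable fun x : S.carrier => x.1 (1 + i) from
      (measurable_pi_apply (1 + i)).comp measurable_subtype_coe

theorem integral_sub_const {X : Type*} [MeasurableSpace X] {μ : Measure X} [IsProbabilityMeasure μ]
    {g : X → ℝ} (hg : Integrable g μ) (c : ℝ) : ∫ x, (g x - c) ∂μ = ∫ x, g x ∂μ - c := by
  rw [integral_sub hg (integrable_const c), integral_const, probReal_univ, one_smul]

theorem dist_integral_le_of_forall_dist_le {X E : Type*} [MeasurableSpace X] {μ : Measure X}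
    [IsProbabilityMeasure μ] [NormedAddCommGroup E] [NormedSpace ℝ E] {f g : X → E}
    (hf : Integrable f μ) (hg : Integrable g μ) {ε : ℝ} (h : ∀ x, dist (f x) (g x) ≤ ε) :
    dist (∫ x, f x ∂μ) (∫ x, g x ∂μ) ≤ ε := by
  rw [dist_eq_norm, ← integral_sub hf hg]
  simpa using norm_integral_le_of_norm_le_const (μ := μ)
    (ae_of_all _ fun x => (dist_eq_norm (f x) (g x)).symm.trans_le (h x))

variable {α : Type*} [Finite α] [TopologicalSpace α] [DiscreteTopology α]
  [MeasurableSpace α] [MeasurableSingletonClass α] {S : Subshift α ℕ} {N : ℕ}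

theorem integrable_of_continuous {E : Type*} [NormedAddCommGroup E] {g : S.carrier → E}
    (hg : Continuous g) (μ : Measure S.carrier) [IsFiniteMeasure μ] : Integrable g μ :=
  hg.integrable_of_hasCompactSupport (HasCompactSupport.of_compactSpace g)

theorem bddAbove_integral_rotationClass {A : S.carrier → ℝ} (hA : Continuous A)
    (φ : S.carrier → ℝ) (h : ℝ) :
    BddAbove ((fun μ : Measure S.carrier => ∫ x, A x ∂μ) '' rotationClass (shiftMap S) φ h) := by
  obtain ⟨C, hC⟩ := (isCompact_range hA).bddAbove
  refine ⟨C, ?_⟩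
  rintro _ ⟨μ, ⟨⟨_, -⟩, -⟩, rfl⟩
  calc ∫ x, A x ∂μ ≤ ∫ _, C ∂μ := integral_mono (integrable_of_continuous hA μ)
        (integrable_const C) fun x => hC ⟨x, rfl⟩
    _ = C := by simp

theorem exists_mem_periodicSums_pos_of_integral_pos {G : Type*} [AddCommMonoid G]
    (hS : HasMemory S N) (hT : IsTransitive (shiftMap S)) {F : S.carrier → G}
    (hF : DependsOnPrefix N F) (l : G →+ ℝ) {μ : Measure S.carrier}
    (hμ : μ ∈ invariantMeasures (shiftMap S)) (hpos : 0 < ∫ x, l (F x) ∂μ) :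
    ∃ v ∈ periodicSums (shiftMap S) F, 0 < l v := by
  have := hμ.1
  have hlF : DependsOnPrefix N (l ∘ F) := fun x y hxy => congrArg l (hF x y hxy)
  by_contra! hle
  obtain ⟨C, hC⟩ := exists_forall_birkhoffSum_le hS hT hlF (by
    rw [periodicSums_comp]
    exact Set.forall_mem_image.2 hle)
  exact hpos.not_ge (integral_nonpos_of_forall_birkhoffSum_le hμ.2
    (integrable_of_continuous hlF.continuous μ) hC)

theorem exists_mem_periodicSums_of_integral (hS : HasMemory S N) (hT : IsTransitive (shiftMap S))
    {F : S.carrier → ℚ × ℝ} (hF : DependsOnPrefix N F) {μ μ₁ μ₂ : Measure S.carrier}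
    (hμ : μ ∈ invariantMeasures (shiftMap S)) (hμ₁ : μ₁ ∈ invariantMeasures (shiftMap S))
    (hμ₂ : μ₂ ∈ invariantMeasures (shiftMap S)) (hfst : ∫ x, ((F x).1 : ℝ) ∂μ = 0)
    (hsnd : 0 < ∫ x, (F x).2 ∂μ) (hneg : ∫ x, ((F x).1 : ℝ) ∂μ₁ < 0)
    (hpos : 0 < ∫ x, ((F x).1 : ℝ) ∂μ₂) :
    ∃ v ∈ periodicSums (shiftMap S) F, v.1 = 0 ∧ 0 < v.2 := by
  have := hμ.1
  let fst : ℚ × ℝ →+ ℝ := (Rat.castHom ℝ : ℚ →+ ℝ).comp (AddMonoidHom.fst ℚ ℝ)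
  let snd : ℚ × ℝ →+ ℝ := AddMonoidHom.snd ℚ ℝ
  by_contra! hcon
  obtain ⟨p, hp, hp₀⟩ := exists_mem_periodicSums_pos_of_integral_pos hS hT hF fst hμ₂ hpos
  obtain ⟨q, hq, hq₀⟩ := exists_mem_periodicSums_pos_of_integral_pos hS hT hF (-fst) hμ₁
    (by simpa [fst, integral_neg] using hneg)
  obtain ⟨a, ha⟩ : ∃ a : ℝ, ∀ v : periodicSums (shiftMap S) F, v.1.2 ≤ a * (v.1.1 : ℝ) := by
    refine exists_forall_le_mul ⟨⟨p, hp⟩, hp₀⟩ ⟨⟨q, hq⟩, neg_pos.1 hq₀⟩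
      (fun v hv => hcon v v.2 (by exact_mod_cast hv)) fun v w hv hw => ?_
    by_contra! hvw
    obtain ⟨u, hu, hu₁, hu₂⟩ := exists_mem_periodicSums_fst_eq_zero_and_snd_pos hS hT hF v.2 w.2
      (by exact_mod_cast hv) (by exact_mod_cast hw) hvw
    exact (hcon u hu hu₁).not_gt hu₂
  have hlagrange : 0 < ∫ x, (snd - (AddMonoidHom.mulLeft a).comp fst) (F x) ∂μ := by
    have hint₁ : Integrable (fun x => ((F x).1 : ℝ)) μ :=
      integrable_of_continuous (DependsOnPrefix.continuous (N := N) fun x y h => by rw [hF x y h]) μ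
    have hint₂ : Integrable (fun x => (F x).2) μ :=
      integrable_of_continuous hF.continuous.snd μ
    have heq : ∫ x, ((F x).2 - a * ((F x).1 : ℝ)) ∂μ = ∫ x, (F x).2 ∂μ := by
      rw [integral_sub hint₂ (hint₁.const_mul a), integral_const_mul, hfst, mul_zero, sub_zero]
    exact heq ▸ hsnd
  obtain ⟨v, hv, hv₀⟩ := exists_mem_periodicSums_pos_of_integral_pos hS hT hF _ hμ hlagrange
  exact (sub_pos.1 hv₀).not_ge (ha ⟨v, hv⟩)

theorem exists_lt_lt_of_mem_interior_rotationSet {X : Type*} [MeasurableSpace X] {T : X → X}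
    {φ : X → ℝ} {r : ℝ} (hr : r ∈ interior (rotationSet T φ)) :
    (∃ μ ∈ invariantMeasures T, ∫ x, φ x ∂μ < r) ∧ ∃ μ ∈ invariantMeasures T, r < ∫ x, φ x ∂μ := by
  have hnhds : ∀ᶠ h in 𝓝 r, h ∈ rotationSet T φ := mem_interior_iff_mem_nhds.1 hr
  obtain ⟨_, hlt, μ₁, hμ₁, rfl⟩ := hnhds.exists_lt
  obtain ⟨_, hgt, μ₂, hμ₂, rfl⟩ := hnhds.exists_gt
  exact ⟨⟨μ₁, hμ₁, hlt⟩, μ₂, hμ₂, hgt⟩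

theorem DependsOnPrefix.exists_isPeriodicMeasure_lt_integral (hS : HasMemory S N)
    (hT : IsTransitive (shiftMap S)) {φ : S.carrier → ℚ} (hφ : DependsOnPrefix N φ) {r : ℚ}
    (hr : (r : ℝ) ∈ interior (rotationSet (shiftMap S) fun x => (φ x : ℝ)))
    {g : S.carrier → ℝ} (hg : DependsOnPrefix N g) {μ : Measure S.carrier}
    (hμ : μ ∈ rotationClass (shiftMap S) (fun x => (φ x : ℝ)) r) {c : ℝ} (hc : c < ∫ x, g x ∂μ) :
    ∃ ν ∈ rotationClass (shiftMap S) (fun x => (φ x : ℝ)) r,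
      IsPeriodicMeasure (shiftMap S) ν ∧ c < ∫ x, g x ∂ν := by
  let F : S.carrier → ℚ × ℝ := fun x => (φ x - r, g x - c)
  have hF : DependsOnPrefix N F := fun x y h => by simp only [F, hφ x y h, hg x y h]
  have hfst : ∀ ν ∈ invariantMeasures (shiftMap S),
      ∫ x, ((F x).1 : ℝ) ∂ν = ∫ x, (φ x : ℝ) ∂ν - r := fun ν hν => by
    have := hν.1
    have hφ' : DependsOnPrefix N fun x => (φ x : ℝ) := fun x y h => congrArg _ (hφ x y h)
    simpa only [F, Rat.cast_sub] using
      integral_sub_const (integrable_of_continuous hφ'.continuous ν) (r : ℝ)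
  have hsnd : ∀ ν ∈ invariantMeasures (shiftMap S), ∫ x, (F x).2 ∂ν = ∫ x, g x ∂ν - c :=
    fun ν hν => have := hν.1; integral_sub_const (integrable_of_continuous hg.continuous ν) c
  obtain ⟨⟨μ₁, hμ₁, hlt⟩, μ₂, hμ₂, hgt⟩ := exists_lt_lt_of_mem_interior_rotationSet hr
  obtain ⟨_, ⟨z, k, hz, rfl⟩, hzφ, hzg⟩ := exists_mem_periodicSums_of_integral hS hT hF hμ.1 hμ₁ hμ₂
    ((hfst μ hμ.1).trans (sub_eq_zero.2 hμ.2)) (hsnd μ hμ.1 ▸ sub_pos.2 hc)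
    (hfst μ₁ hμ₁ ▸ sub_neg.2 hlt) (hfst μ₂ hμ₂ ▸ sub_pos.2 hgt)
  have hk : 0 < k := Nat.pos_of_ne_zero fun hk => by simp [hk] at hzg
  have hinv := orbitMeasure_mem_invariantMeasures (measurable_shiftMap S) hk hz
  have hφν : ∫ x, ((F x).1 : ℝ) ∂orbitMeasure (shiftMap S) k z = 0 :=
    (integral_addMonoidHom_comp_orbitMeasure
      ((Rat.castHom ℝ : ℚ →+ ℝ).comp (AddMonoidHom.fst ℚ ℝ)) F).trans (by simp [hzφ])
  have hgν : 0 < ∫ x, (F x).2 ∂orbitMeasure (shiftMap S) k z :=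
    (mul_pos (by positivity) hzg).trans_eq
      (integral_addMonoidHom_comp_orbitMeasure (AddMonoidHom.snd ℚ ℝ) F).symm
  exact ⟨_, ⟨hinv, sub_eq_zero.1 ((hfst _ hinv).symm.trans hφν)⟩, ⟨z, k, hk, hz, rfl⟩,
    sub_pos.1 (hsnd _ hinv ▸ hgν)⟩

theorem exists_isPeriodicMeasure_lt_integral (hS : IsFiniteType S)
    (hT : IsTransitive (shiftMap S)) {φ : S.carrier → ℚ} (hφ : IsLocConst S φ) {r : ℚ}
    (hr : (r : ℝ) ∈ interior (rotationSet (shiftMap S) fun x => (φ x : ℝ)))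
    {A : S.carrier → ℝ} (hA : Continuous A) {μ : Measure S.carrier}
    (hμ : μ ∈ rotationClass (shiftMap S) (fun x => (φ x : ℝ)) r) {c : ℝ} (hc : c < ∫ x, A x ∂μ) :
    ∃ ν ∈ rotationClass (shiftMap S) (fun x => (φ x : ℝ)) r,
      IsPeriodicMeasure (shiftMap S) ν ∧ c < ∫ x, A x ∂ν := by
  obtain ⟨ε, hε, hcε⟩ : ∃ ε > 0, c + 2 * ε < ∫ x, A x ∂μ :=
    ⟨(∫ x, A x ∂μ - c) / 3, by linarith, by linarith⟩
  obtain ⟨N, hSN, hφN, g, hg, hgA⟩ := (hS.eventually_hasMemory.and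
    (hφ.eventually_dependsOnPrefix.and (eventually_exists_dependsOnPrefix_dist_lt hA hε))).exists
  have hclose : ∀ ν ∈ invariantMeasures (shiftMap S), |∫ x, g x ∂ν - ∫ x, A x ∂ν| ≤ ε :=
    fun ν hν => have := hν.1
    dist_integral_le_of_forall_dist_le (integrable_of_continuous hg.continuous ν)
      (integrable_of_continuous hA ν) fun x => (hgA x).le
  obtain ⟨ν, hν, hper, hlt⟩ := hφN.exists_isPeriodicMeasure_lt_integral hSN hT hr hg hμ
    (show c + ε < ∫ x, g x ∂μ by linarith [(abs_le.1 (hclose μ hμ.1)).1])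
  exact ⟨ν, hν, hper, by linarith [(abs_le.1 (hclose ν hν.1)).2]⟩

end InvariantMeasures

end ErgOpt

theorem proposition14_general {α : Type*} [Finite α] [TopologicalSpace α] [DiscreteTopology α]
    [MeasurableSpace α] [MeasurableSingletonClass α]
    (S : SymbolicDynamics.FullShift.Subshift α ℕ)
    (hS : ErgOpt.IsFiniteType S)
    (hT : ErgOpt.IsTransitive (ErgOpt.shiftMap S))
    (φ : S.carrier → ℚ) (hφ : ErgOpt.IsLocConst S φ)
    (A : S.carrier → ℝ) (hA : Continuous A)
    (r : ℚ)
    (hr : (r : ℝ) ∈ interior (ErgOpt.rotationSet (ErgOpt.shiftMap S) (fun x => (φ x : ℝ)))) :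
    IsLUB
      {a : ℝ | ∃ μ ∈ ErgOpt.rotationClass (ErgOpt.shiftMap S) (fun x => (φ x : ℝ)) (r : ℝ),
        ErgOpt.IsPeriodicMeasure (ErgOpt.shiftMap S) μ ∧ ∫ x, A x ∂μ = a}
      (ErgOpt.beta (ErgOpt.shiftMap S) A (fun x => (φ x : ℝ)) (r : ℝ)) := by
  refine ⟨?_, fun b hb => ?_⟩
  · rintro _ ⟨μ, hμ, -, rfl⟩
    exact le_csSup (ErgOpt.bddAbove_integral_rotationClass hA _ _) ⟨μ, hμ, rfl⟩
  · obtain ⟨μ₀, hμ₀, hrot⟩ := interior_subset hr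
    refine csSup_le (Set.Nonempty.image _ ⟨μ₀, hμ₀, hrot⟩) ?_
    rintro _ ⟨μ, hμ, rfl⟩
    refine le_of_forall_lt fun c hc => ?_
    obtain ⟨ν, hν, hper, hcν⟩ := ErgOpt.exists_isPeriodicMeasure_lt_integral hS hT hφ hr hA hμ hc
    exact hcν.trans_le (hb ⟨ν, hν, hper, rfl⟩)

theorem proposition14 {α : Type*} [Finite α] [TopologicalSpace α] [DiscreteTopology α]
    [MeasurableSpace α] [MeasurableSingletonClass α]
    (S : SymbolicDynamics.FullShift.Subshift α ℕ)
    (hS : ErgOpt.IsFiniteType S)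
    (hT : ErgOpt.IsTransitive (ErgOpt.shiftMap S))
    (lam : ℝ≥0) (hlam0 : 0 < lam) (hlam1 : lam < 1)
    (φ : S.carrier → ℚ) (hφ : ErgOpt.IsLocConst S φ)
    (A : S.carrier → ℝ)
    (hA : ErgOpt.IsWalters (ErgOpt.shiftMap S) (ErgOpt.shiftDist S lam) A)
    (r : ℚ)
    (hr : (r : ℝ) ∈ interior (ErgOpt.rotationSet (ErgOpt.shiftMap S) (fun x => (φ x : ℝ)))) :
    IsLUB
      {a : ℝ | ∃ μ ∈ ErgOpt.rotationClass (ErgOpt.shiftMap S) (fun x => (φ x : ℝ)) (r : ℝ),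
        ErgOpt.IsPeriodicMeasure (ErgOpt.shiftMap S) μ ∧ ∫ x, A x ∂μ = a}
      (ErgOpt.beta (ErgOpt.shiftMap S) A (fun x => (φ x : ℝ)) (r : ℝ)) :=
  proposition14_general S hS hT φ hφ A hA.1 r hr
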